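/- Fix a period $T>0$ and a central mass $m_0\ge 0$. Let $\{I,R_2,R_3,R_4\}\cong\mathbb{Z}_2\times\mathbb{Z}_2$ be the Klein group, where $R_2=\mathrm{diag}(1,-1,-1)$, $R_3=\mathrm{diag}(-1,1,-1)$, $R_4=\mathrm{diag}(-1,-1,1)$ are the rotations of $\pi$ around the coordinate axes of $\mathbb{R}^3$, and let $\Gamma=\{x\in\mathbb{R}^3: Rx=x \text{ for some } R\in\{R_2,R_3,R_4\}\}$ be the union of the three coordinate axes. Let $\widetilde R_j$ be the reflection with respect to the plane $\{x_j=0\}$, and let $S_1=\{\alpha e_1+\beta e_2:\alpha,\beta>0\}$, $S_2=\{-\alpha e_1+\beta e_3:\alpha,\beta>0\}$. Denote by $\mathcal{K}$ the set of $T$-periodic $H^1$ loops $u_I:\mathbb{R}\to\mathbb{R}^3\setminus\Gamma$ such that, for all $t\in\mathbb{R}$, \[ u_I(t)=\widetilde R_3\,u_I(-t),\qquad u_I(t)=\widetilde R_2\,u_I(T/2-t), \] and $u_I(0)\in S_1$, $u_I(T/4)\in S_2$. Let $\overline{\mathcal{K}}$ be the closure of $\mathcal{K}$ in the $H^1$ norm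 on $T$-periodic loops in $\mathbb{R}^3$. To a loop $u_I$ associate the motion of four satellites of unit mass $u_R(t)=R\,u_I(t)$, $R\in\{I,R_2,R_3,R_4\}$, with a central body of mass $m_0$ at rest at the origin, and its Newtonian Lagrangian action \[ \mathcal{A}(u_I)=\int_0^T\Big(\tfrac12\sum_{R}|\dot u_R|^2+\sum_R\frac{m_0}{|u_R|}+\sum_{\{R,R'\},\,R\ne R'}\frac{1}{|u_R-u_{R'}|}\Big)dt =4\int_0^T\Big(\frac{|\dot u_I|^2}{2}+\frac{m_0}{|u_I|}+\frac12\sum_{R\neq I}\frac{1}{|(R-I)u_I|}\Big)dt\in[0,+\infty]. \] Then every minimizer $u_I^*$ of $\mathcal{A}$ over $\overline{\mathcal{K}}$ is free of total collisions: there is no time $t$ at which all the satellites are at the origin (equivalently, $u_I^*(t)\neq 0$ for every $t\in\mathbb{R}$). -/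

import Mathlib

open MeasureTheory Set
open scoped ENNReal

namespace KleinSatellites

/-- Three-dimensional Euclidean space. -/
abbrev E3 : Type := EuclideanSpace ℝ (Fin 3)

/-! ### The rotations of the Klein group and the coordinate reflections -/

/-- The elements `I, R₂, R₃, R₄` of the Klein group `ℤ₂ × ℤ₂`: the identity and the rotations
of angle `π` around the three coordinate axes. -/
def kleinMatrix : Fin 4 → Matrix (Fin 3) (Fin 3) ℝ :=
  ![1,
    !![1, 0, 0; 0, -1, 0; 0, 0, -1],
    !![-1, 0, 0; 0, 1, 0; 0, 0, -1],
    !![-1, 0, 0; 0, -1, 0; 0, 0, 1]]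

/-- The linear isometry of `ℝ³` given by an element of the Klein group. -/
noncomputable def kleinRot (i : Fin 4) : E3 →ₗ[ℝ] E3 :=
  Matrix.toEuclideanLin (kleinMatrix i)

/-- The reflection of `ℝ³` with respect to the coordinate plane `{x_j = 0}` (coordinates are
numbered from `0`, so `j = 1` is the plane `{x₂ = 0}` and `j = 2` the plane `{x₃ = 0}`). -/
noncomputable def coordReflection (j : Fin 3) : E3 →ₗ[ℝ] E3 :=
  Matrix.toEuclideanLin (Matrix.diagonal fun k => if k = j then (-1 : ℝ) else 1)

/-- The collision set: the points fixed by some rotation of the group other than the identity. -/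
def collisionSet : Set E3 := {x | ∃ i : Fin 4, i ≠ 0 ∧ kleinRot i x = x}

/-! ### The action of the `(1+4)`-body problem -/

/-- The configuration of the four satellites determined by the generating particle:
`u_R = R u_I` for every `R` in the group. -/
noncomputable def satellites (u : ℝ → E3) (i : Fin 4) (t : ℝ) : E3 := kleinRot i (u t)

/-- The kinetic energy `(1/2) ∑ |w_i|²` of four satellites of unit mass with velocities `w_i`,
as an extended non-negative number. -/
noncomputable def kineticEnergy (w : Fin 4 → E3) : ℝ≥0∞ := (∑ i, ‖w i‖ₑ ^ 2) / 2

/-- The Newtonian potential `∑ m₀ / |x_i| + ∑_{i<j} 1 / |x_i - x_j|` of four satellites of unit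
mass and a central body of mass `m₀` at the origin, with value `∞` when two satellites coincide. -/
noncomputable def potential (m₀ : ℝ) (x : Fin 4 → E3) : ℝ≥0∞ :=
  (∑ i, ENNReal.ofReal m₀ / ‖x i‖ₑ) + ∑ i, ∑ j ∈ Finset.Ioi i, 1 / ‖x i - x j‖ₑ

/-- The Lagrangian action, over one period, of the symmetric motion of the four satellites
generated by `u`, with values in `[0, ∞]`. -/
noncomputable def action (m₀ T : ℝ) (u : ℝ → E3) : ℝ≥0∞ :=
  ∫⁻ t in Ioc 0 T,
    (kineticEnergy (fun i => deriv (satellites u i) t) + potential m₀ (fun i => satellites u i t))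

/-! ### Sobolev loops -/

/-- `u` is (the continuous representative of) a `T`-periodic loop of class `H¹`: it is
`T`-periodic, absolutely continuous on a period, and its derivative, which exists almost
everywhere, is square integrable on a period. -/
structure IsH1Loop (T : ℝ) (u : ℝ → E3) : Prop where
  periodic : Function.Periodic u T
  absolutelyContinuous : AbsolutelyContinuousOnInterval u 0 T
  memLp_deriv : MemLp (deriv u) 2 (volume.restrict (Ioc 0 T))

/-- The distance of two loops in the `H¹` norm
`‖u‖² = ∫₀ᵀ |u|² + |u̇|²`. -/
noncomputable def h1Dist (T : ℝ) (u v : ℝ → E3) : ℝ≥0∞ :=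
  (∫⁻ t in Ioc 0 T, (‖u t - v t‖ₑ ^ 2 + ‖deriv u t - deriv v t‖ₑ ^ 2)) ^ (1 / 2 : ℝ)

/-- The closure, in the space of `T`-periodic `H¹` loops, of a set of loops. -/
def h1Closure (T : ℝ) (K : Set (ℝ → E3)) : Set (ℝ → E3) :=
  {u | IsH1Loop T u ∧ ∀ ε : ℝ≥0∞, 0 < ε → ∃ v ∈ K, h1Dist T u v < ε}

/-! ### The set of admissible loops -/

/-- The open quadrant `{α e₁ + β e₂ : α, β > 0}`. -/
def quadrantS1 : Set E3 := {x | ∃ α β : ℝ, 0 < α ∧ 0 < β ∧ x = !₂[α, β, 0]}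

/-- The open quadrant `{-α e₁ + β e₃ : α, β > 0}`. -/
def quadrantS2 : Set E3 := {x | ∃ α β : ℝ, 0 < α ∧ 0 < β ∧ x = !₂[-α, 0, β]}

/-- The set `𝒦` of admissible motions of the generating particle: the `T`-periodic `H¹` loops
in `ℝ³ \ Γ` with the two reflection symmetries and the two quadrant conditions. -/
def admissibleLoops (T : ℝ) : Set (ℝ → E3) :=
  {u | IsH1Loop T u ∧ (∀ t, u t ∉ collisionSet) ∧
    (∀ t, u t = coordReflection 2 (u (-t))) ∧
    (∀ t, u t = coordReflection 1 (u (T / 2 - t))) ∧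
    u 0 ∈ quadrantS1 ∧ u (T / 4) ∈ quadrantS2}

/-- The motion generated by `u` has a total collision: at some time all the satellites are at
the origin, where the central body is. -/
def HasTotalCollision (u : ℝ → E3) : Prop := ∃ t, ∀ i, satellites u i t = 0

end KleinSatellites

namespace KleinSatellites

/-! ### Coordinates of the symmetry group -/

/-! The proof compares levels: every loop of the closure with a total collision has larger action
than one explicit collision-free loop.

Lower bound. With `ρₖ` the distances to the axes, the potential is `4 m₀ / |x| + ∑ 1 / ρₖ`. Since `∑
ρₖ² = 2 |x|²`, convexity gives at least `4 α / |x|` with `α = m₀ + 9/10` (`le_potential`), so the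
action dominates four times that of a rectilinear Kepler motion of `|u|`. Let `R = max |u|`.
Calibrating with a subsolution of the Hamilton-Jacobi equation at energy `-α / R` (`le_lagrangian`)
bounds the Lagrangian below by `4 α / R` plus four times the speed of a monotone function of `|u|`.
The two reflections make `|u|` periodic of period `T / 2`, and this survives in the closure
(`norm_add_half_period_of_mem_h1Closure`). So each half period goes from `0` to `R` and back, giving
four radial excursions per period (`le_action_of_collision`).

Upper bound. `tennisLoop`, at its optimal radius, is admissible; its action is estimated with `Q =
m₀ + 41/40` in place of `α` (`action_tennisLoop_le`). After optimising in the radius `b` and in the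
unknown `R`, both levels scale as `T ^ (1/3)`, and the comparison reduces to `π² Q² < (27/2) α²`,
which holds for every `m₀ ≥ 0` (`exists_radius_action_lt`). -/

theorem kleinRot_zero_apply (x : E3) : kleinRot 0 x = x := by
  ext k; fin_cases k <;> simp [kleinRot, kleinMatrix]

theorem kleinRot_one_apply (x : E3) : kleinRot 1 x = !₂[x 0, -x 1, -x 2] := by
  ext k
  fin_cases k <;> simp [kleinRot, kleinMatrix, Matrix.mulVec, dotProduct, Fin.sum_univ_three]

theorem kleinRot_two_apply (x : E3) : kleinRot 2 x = !₂[-x 0, x 1, -x 2] := by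
  ext k
  fin_cases k <;> simp [kleinRot, kleinMatrix, Matrix.mulVec, dotProduct, Fin.sum_univ_three]

theorem kleinRot_three_apply (x : E3) : kleinRot 3 x = !₂[-x 0, -x 1, x 2] := by
  ext k
  fin_cases k <;> simp [kleinRot, kleinMatrix, Matrix.mulVec, dotProduct, Fin.sum_univ_three]

theorem coordReflection_apply (j : Fin 3) (x : E3) (k : Fin 3) :
    coordReflection j x k = if k = j then -x k else x k := by
  simp [coordReflection, Matrix.mulVec_diagonal]

theorem norm_sq_eq_coords (x : E3) : ‖x‖ ^ 2 = x 0 ^ 2 + x 1 ^ 2 + x 2 ^ 2 := by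
  simp [EuclideanSpace.norm_sq_eq, Fin.sum_univ_three]

theorem norm_kleinRot (i : Fin 4) (x : E3) : ‖kleinRot i x‖ = ‖x‖ := by
  rw [← sq_eq_sq₀ (norm_nonneg _) (norm_nonneg _), norm_sq_eq_coords, norm_sq_eq_coords]
  fin_cases i <;>
    simp [kleinRot_zero_apply, kleinRot_one_apply, kleinRot_two_apply, kleinRot_three_apply]

theorem norm_coordReflection (j : Fin 3) (x : E3) : ‖coordReflection j x‖ = ‖x‖ := by
  rw [← sq_eq_sq₀ (norm_nonneg _) (norm_nonneg _), norm_sq_eq_coords, norm_sq_eq_coords]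
  simp only [coordReflection_apply]
  fin_cases j <;> simp

/-- The distance of a point from the `k`-th coordinate axis. -/
noncomputable def axisDist (k : Fin 3) (x : E3) : ℝ := √(‖x‖ ^ 2 - x k ^ 2)

theorem axisDist_sq (k : Fin 3) (x : E3) : axisDist k x ^ 2 = ‖x‖ ^ 2 - x k ^ 2 := by
  refine Real.sq_sqrt ?_
  rw [norm_sq_eq_coords]
  fin_cases k <;> simp <;> linarith [sq_nonneg (x 0), sq_nonneg (x 1), sq_nonneg (x 2)]

theorem axisDist_nonneg (k : Fin 3) (x : E3) : 0 ≤ axisDist k x := Real.sqrt_nonneg _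

theorem sum_axisDist_sq (x : E3) :
    axisDist 0 x ^ 2 + axisDist 1 x ^ 2 + axisDist 2 x ^ 2 = 2 * ‖x‖ ^ 2 := by
  simp only [axisDist_sq]
  rw [norm_sq_eq_coords]
  ring

theorem enorm_eq_two_mul_axisDist {k : Fin 3} {x y : E3}
    (h : ‖y‖ ^ 2 = 4 * (‖x‖ ^ 2 - x k ^ 2)) : ‖y‖ₑ = ENNReal.ofReal (2 * axisDist k x) := by
  rw [← ofReal_norm]
  congr 1
  rw [← sq_eq_sq₀ (norm_nonneg _) (mul_nonneg zero_le_two (axisDist_nonneg _ _)), h, mul_pow,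
    axisDist_sq]
  ring

/-- Since the group acts by isometries, `|R x - R' x|` depends only on the rotation `R⁻¹ R'`, and a
rotation by `π` moves `x` by twice its distance to the axis. Each of the three rotations comes from
two of the six pairs. -/
theorem potential_kleinRot (m₀ : ℝ) (x : E3) :
    potential m₀ (fun i => kleinRot i x) = 4 * (ENNReal.ofReal m₀ / ‖x‖ₑ) +
      2 * ∑ k, 1 / ENNReal.ofReal (2 * axisDist k x) := by
  have e : ∀ i, ‖kleinRot i x‖ₑ = ‖x‖ₑ := fun i => by
    rw [← ofReal_norm, norm_kleinRot, ofReal_norm]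
  have h01 : ‖kleinRot 0 x - kleinRot 1 x‖ₑ = ENNReal.ofReal (2 * axisDist 0 x) := by
    refine enorm_eq_two_mul_axisDist ?_
    rw [norm_sq_eq_coords, norm_sq_eq_coords]; simp [kleinRot_zero_apply, kleinRot_one_apply]; ring
  have h02 : ‖kleinRot 0 x - kleinRot 2 x‖ₑ = ENNReal.ofReal (2 * axisDist 1 x) := by
    refine enorm_eq_two_mul_axisDist ?_
    rw [norm_sq_eq_coords, norm_sq_eq_coords]; simp [kleinRot_zero_apply, kleinRot_two_apply]; ring
  have h03 : ‖kleinRot 0 x - kleinRot 3 x‖ₑ = ENNReal.ofReal (2 * axisDist 2 x) := by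
    refine enorm_eq_two_mul_axisDist ?_
    rw [norm_sq_eq_coords, norm_sq_eq_coords]
    simp [kleinRot_zero_apply, kleinRot_three_apply]; ring
  have h12 : ‖kleinRot 1 x - kleinRot 2 x‖ₑ = ENNReal.ofReal (2 * axisDist 2 x) := by
    refine enorm_eq_two_mul_axisDist ?_
    rw [norm_sq_eq_coords, norm_sq_eq_coords]; simp [kleinRot_one_apply, kleinRot_two_apply]; ring
  have h13 : ‖kleinRot 1 x - kleinRot 3 x‖ₑ = ENNReal.ofReal (2 * axisDist 1 x) := by
    refine enorm_eq_two_mul_axisDist ?_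
    rw [norm_sq_eq_coords, norm_sq_eq_coords]; simp [kleinRot_one_apply, kleinRot_three_apply]; ring
  have h23 : ‖kleinRot 2 x - kleinRot 3 x‖ₑ = ENNReal.ofReal (2 * axisDist 0 x) := by
    refine enorm_eq_two_mul_axisDist ?_
    rw [norm_sq_eq_coords, norm_sq_eq_coords]; simp [kleinRot_two_apply, kleinRot_three_apply]; ring
  have i0 : Finset.Ioi (0 : Fin 4) = {1, 2, 3} := by decide
  have i1 : Finset.Ioi (1 : Fin 4) = {2, 3} := by decide
  have i2 : Finset.Ioi (2 : Fin 4) = {3} := by decide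
  have i3 : Finset.Ioi (3 : Fin 4) = ∅ := by decide
  simp only [potential, e, Fin.sum_univ_four, Fin.sum_univ_three, i0, i1, i2, i3]
  simp only [Finset.mem_insert, Finset.mem_singleton, Fin.reduceEq, or_self, not_false_eq_true,
    Finset.sum_insert, Finset.sum_singleton, Finset.sum_empty, h01, h02, h03, h12, h13, h23]
  ring

theorem potential_eq_ofReal {m₀ : ℝ} (hm₀ : 0 ≤ m₀) {x : E3} (hx : x ≠ 0)
    (h : ∀ k, 0 < axisDist k x) :
    potential m₀ (fun i => kleinRot i x) =
      ENNReal.ofReal (4 * (m₀ / ‖x‖) + ∑ k, 1 / axisDist k x) := by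
  have hx' : 0 < ‖x‖ := norm_pos_iff.2 hx
  have e : ∀ k, 1 / ENNReal.ofReal (2 * axisDist k x) = ENNReal.ofReal (1 / (2 * axisDist k x)) :=
    fun k => by
      rw [ENNReal.ofReal_div_of_pos (mul_pos two_pos (h k)), ENNReal.ofReal_one]
  have hn : ∀ k, 0 ≤ 1 / (2 * axisDist k x) := fun k => by have := h k; positivity
  have e4 : ∀ y : ℝ≥0∞, 4 * y = ENNReal.ofReal 4 * y := by simp
  have e2 : ∀ y : ℝ≥0∞, 2 * y = ENNReal.ofReal 2 * y := by simp
  rw [potential_kleinRot, ← ofReal_norm, ← ENNReal.ofReal_div_of_pos hx']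
  simp only [e]
  rw [← ENNReal.ofReal_sum_of_nonneg (fun k _ => hn k),
    e4, e2, ← ENNReal.ofReal_mul (by norm_num), ← ENNReal.ofReal_mul (by norm_num),
    ← ENNReal.ofReal_add (by positivity) (mul_nonneg zero_le_two (Finset.sum_nonneg fun k _ => hn k)),
    Finset.mul_sum]
  congr 2
  refine Finset.sum_congr rfl fun k _ => ?_
  have := h k
  field_simp

theorem potential_eq_top_of_axisDist_eq_zero (m₀ : ℝ) {x : E3} {k : Fin 3}
    (h : axisDist k x = 0) : potential m₀ (fun i => kleinRot i x) = ⊤ := by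
  have : ∑ k, 1 / ENNReal.ofReal (2 * axisDist k x) = ⊤ :=
    ENNReal.sum_eq_top.2 ⟨k, Finset.mem_univ _, by simp [h]⟩
  rw [potential_kleinRot, this]
  simp

theorem potential_zero (m₀ : ℝ) : potential m₀ (fun i => kleinRot i (0 : E3)) = ⊤ :=
  potential_eq_top_of_axisDist_eq_zero m₀ (k := 0) (by simp [axisDist])

/-- Tangent line at `ρ = s` of `1 / ρ`, seen as a convex function of `ρ ^ 2`; this variable is
chosen because the sum of the `ρ ^ 2` is known. -/
theorem inv_ge_tangent {ρ s : ℝ} (hρ : 0 < ρ) (hs : 0 < s) :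
    3 / (2 * s) - ρ ^ 2 / (2 * s ^ 3) ≤ 1 / ρ := by
  have : 1 / ρ - (3 / (2 * s) - ρ ^ 2 / (2 * s ^ 3)) =
      (ρ - s) ^ 2 * (ρ + 2 * s) / (2 * s ^ 3 * ρ) := by
    field_simp; ring
  have : 0 ≤ (ρ - s) ^ 2 * (ρ + 2 * s) / (2 * s ^ 3 * ρ) := by positivity
  linarith

theorem le_potential {m₀ : ℝ} (hm₀ : 0 ≤ m₀) {x : E3} (hx : x ≠ 0) :
    ENNReal.ofReal (4 * ((m₀ + 9 / 10) / ‖x‖)) ≤ potential m₀ (fun i => kleinRot i x) := by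
  by_cases h : ∃ k, axisDist k x = 0
  · obtain ⟨k, hk⟩ := h
    rw [potential_eq_top_of_axisDist_eq_zero m₀ hk]
    exact le_top
  push Not at h
  have h' : ∀ k, 0 < axisDist k x := fun k => lt_of_le_of_ne (axisDist_nonneg k x) (h k).symm
  rw [potential_eq_ofReal hm₀ hx h']
  refine ENNReal.ofReal_le_ofReal ?_
  have hx' : 0 < ‖x‖ := norm_pos_iff.2 hx
  -- The optimal tangency point is `√(2/3) ‖x‖`, where the three distances agree. The rational `4/5`
  -- gives `235/64`, still above the required `36/10`.
  have hs : 0 < 4 / 5 * ‖x‖ := by positivity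
  have t0 := inv_ge_tangent (h' 0) hs
  have t1 := inv_ge_tangent (h' 1) hs
  have t2 := inv_ge_tangent (h' 2) hs
  have e := sum_axisDist_sq x
  rw [Fin.sum_univ_three]
  have key : 3 * (3 / (2 * (4 / 5 * ‖x‖))) - (axisDist 0 x ^ 2 + axisDist 1 x ^ 2 +
      axisDist 2 x ^ 2) / (2 * (4 / 5 * ‖x‖) ^ 3) = (235 / 64) / ‖x‖ := by
    rw [e]; field_simp; norm_num
  have : (36 / 10) / ‖x‖ ≤ (235 / 64) / ‖x‖ :=
    div_le_div_of_nonneg_right (by norm_num) hx'.le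
  have e2 : 4 * ((m₀ + 9 / 10) / ‖x‖) = 4 * (m₀ / ‖x‖) + (36 / 10) / ‖x‖ := by ring
  rw [e2]
  have e3 : (axisDist 0 x ^ 2 + axisDist 1 x ^ 2 + axisDist 2 x ^ 2) / (2 * (4 / 5 * ‖x‖) ^ 3)
    = axisDist 0 x ^ 2 / (2 * (4 / 5 * ‖x‖) ^ 3) + axisDist 1 x ^ 2 / (2 * (4 / 5 * ‖x‖) ^ 3) +
      axisDist 2 x ^ 2 / (2 * (4 / 5 * ‖x‖) ^ 3) := by ring
  linarith

theorem kineticEnergy_satellites {u : ℝ → E3} {t : ℝ} (h : DifferentiableAt ℝ u t) :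
    kineticEnergy (fun i => deriv (satellites u i) t) = ENNReal.ofReal (2 * ‖deriv u t‖ ^ 2) := by
  have e : ∀ i, ‖deriv (satellites u i) t‖ₑ = ENNReal.ofReal ‖deriv u t‖ := fun i => by
    have : HasDerivAt (satellites u i) (kleinRot i (deriv u t)) t :=
      (LinearMap.toContinuousLinearMap (kleinRot i)).hasFDerivAt.comp_hasDerivAt t h.hasDerivAt
    rw [this.deriv, ← ofReal_norm, norm_kleinRot]
  have h2 : (4 : ℝ≥0∞) / 2 = 2 := by
    rw [show (4 : ℝ≥0∞) = 2 * 2 by norm_num, ENNReal.mul_div_cancel_right (by simp) (by simp)]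
  simp only [kineticEnergy, e]
  rw [ENNReal.ofReal_mul zero_le_two, ENNReal.ofReal_pow (norm_nonneg _), Finset.sum_const,
    Finset.card_univ, Fintype.card_fin, nsmul_eq_mul, mul_comm, mul_div_assoc, mul_comm]
  congr 1
  simpa using h2

/-! ### Absolutely continuous functions -/

theorem _root_.AbsolutelyContinuousOnInterval.norm {E : Type*} [NormedAddCommGroup E]
    {u : ℝ → E} {a b : ℝ} (hu : AbsolutelyContinuousOnInterval u a b) :
    AbsolutelyContinuousOnInterval (fun t => ‖u t‖) a b :=
  squeeze_zero (fun _ => Finset.sum_nonneg fun _ _ => dist_nonneg)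
    (fun _ => Finset.sum_le_sum fun _ _ => by
      rw [Real.dist_eq, dist_eq_norm]; exact abs_norm_sub_norm_le _ _) hu

theorem abs_deriv_norm_le {E : Type*} [NormedAddCommGroup E] [NormedSpace ℝ E] {u : ℝ → E}
    {t : ℝ} (hu : DifferentiableAt ℝ u t) (hr : DifferentiableAt ℝ (fun s => ‖u s‖) t) :
    |deriv (fun s => ‖u s‖) t| ≤ ‖deriv u t‖ := by
  refine le_of_tendsto_of_tendsto (hasDerivAt_iff_tendsto_slope.1 hr.hasDerivAt).abs
    (hasDerivAt_iff_tendsto_slope.1 hu.hasDerivAt).norm (Filter.Eventually.of_forall fun s => ?_)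
  simp only [slope_def_module, norm_smul, smul_eq_mul, abs_mul, Real.norm_eq_abs]
  exact mul_le_mul_of_nonneg_left (abs_norm_sub_norm_le _ _) (abs_nonneg _)

theorem enorm_sub_le_lintegral_deriv {H : ℝ → ℝ} {a b p q : ℝ}
    (hH : AbsolutelyContinuousOnInterval H a b) (hap : a ≤ p) (hpq : p ≤ q) (hqb : q ≤ b) :
    ‖H q - H p‖ₑ ≤ ∫⁻ t in Ioc p q, ‖deriv H t‖ₑ := by
  have h : AbsolutelyContinuousOnInterval H p q :=
    hH.mono (by
      rw [uIcc_of_le hpq, uIcc_of_le (hap.trans (hpq.trans hqb))]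
      exact Icc_subset_Icc hap hqb)
  rw [← h.integral_deriv_eq_sub, intervalIntegral.integral_of_le hpq]
  exact enorm_integral_le_lintegral_enorm _

/-- On a closed curve every variation is run through twice. -/
theorem two_mul_enorm_sub_le_lintegral_deriv {H : ℝ → ℝ} {a b p q : ℝ}
    (hH : AbsolutelyContinuousOnInterval H a b) (hp : p ∈ Icc a b) (hq : q ∈ Icc a b)
    (hab : H a = H b) : 2 * ‖H q - H p‖ₑ ≤ ∫⁻ t in Ioc a b, ‖deriv H t‖ₑ := by
  wlog hpq : p ≤ q generalizing p q
  · rw [enorm_sub_rev]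
    exact this hq hp (not_le.1 hpq).le
  have s1 : ∫⁻ t in Ioc a b, ‖deriv H t‖ₑ = (∫⁻ t in Ioc a p, ‖deriv H t‖ₑ) +
      ((∫⁻ t in Ioc p q, ‖deriv H t‖ₑ) + ∫⁻ t in Ioc q b, ‖deriv H t‖ₑ) := by
    rw [← lintegral_union measurableSet_Ioc (Ioc_disjoint_Ioc_of_le le_rfl),
      Ioc_union_Ioc_eq_Ioc hpq hq.2,
      ← lintegral_union measurableSet_Ioc (Ioc_disjoint_Ioc_of_le le_rfl),
      Ioc_union_Ioc_eq_Ioc hp.1 hp.2]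
  have h1 := enorm_sub_le_lintegral_deriv hH le_rfl hp.1 hp.2
  have h2 := enorm_sub_le_lintegral_deriv hH hp.1 hpq hq.2
  have h3 := enorm_sub_le_lintegral_deriv hH hq.1 hq.2 le_rfl
  -- The complementary arc from `q` to `p` through the identified endpoints covers the same
  -- difference once more.
  have h4 : ‖H q - H p‖ₑ ≤ ‖H p - H a‖ₑ + ‖H b - H q‖ₑ := by
    rw [enorm_sub_rev]
    calc ‖H p - H q‖ₑ = ‖(H p - H a) + (H b - H q)‖ₑ := by rw [hab]; congr 1; ring
      _ ≤ _ := enorm_add_le _ _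
  calc 2 * ‖H q - H p‖ₑ ≤ (‖H p - H a‖ₑ + ‖H b - H q‖ₑ) + ‖H q - H p‖ₑ := by
        rw [two_mul]; gcongr
    _ ≤ ((∫⁻ t in Ioc a p, ‖deriv H t‖ₑ) + ∫⁻ t in Ioc q b, ‖deriv H t‖ₑ) +
        ∫⁻ t in Ioc p q, ‖deriv H t‖ₑ := by gcongr
    _ = _ := by rw [s1]; ring

/-! ### The lower bound for motions with a total collision -/

/-- A polynomial subsolution of the Hamilton-Jacobi equation `x (S' ^ 2 + 1) = 1` of the
rectilinear Kepler problem on `[0, 1]`. -/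
noncomputable def radialCalibration (x : ℝ) : ℝ := x * (13 / 4 + x * (-(33 / 8) + x * (3 + -1 * x)))

/-- The derivative of `radialCalibration`. -/
noncomputable def radialMomentum (x : ℝ) : ℝ := (1 - x) * (13 / 4 - 5 * x + 4 * x ^ 2)

theorem hasDerivAt_radialCalibration (x : ℝ) :
    HasDerivAt radialCalibration (radialMomentum x) x := by
  have h := (hasDerivAt_id x).mul (((hasDerivAt_id x).mul
    (((hasDerivAt_id x).mul (((hasDerivAt_id x).const_mul (-1)).const_add 3)).const_add
      (-(33 / 8)))).const_add (13 / 4))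
  convert! h using 1
  simp [radialMomentum]
  ring

theorem radialMomentum_nonneg {x : ℝ} (h : x ≤ 1) : 0 ≤ radialMomentum x :=
  mul_nonneg (sub_nonneg.2 h) (by nlinarith [sq_nonneg (8 * x - 5)])

/-- The subsolution inequality. The true momentum `√(1 / x - 1)` has integral `π / 2` over `[0, 1]`;
the polynomial only yields `9 / 8`, which is enough and avoids the singularity at `0`. -/
theorem radialMomentum_sq_le {x : ℝ} (h0 : 0 < x) (h1 : x ≤ 1) :
    radialMomentum x ^ 2 ≤ 1 / x - 1 := by
  have key : x * (1 - x) * (13 / 4 - 5 * x + 4 * x ^ 2) ^ 2 ≤ 1 := by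
    nlinarith [mul_nonneg h0.le (sub_nonneg.2 h1), sq_nonneg (x - 1 / 5),
      sq_nonneg (x * (x - 1 / 5)), sq_nonneg (x ^ 2 * (x - 1 / 5)), sq_nonneg (x ^ 3 - x),
      sq_nonneg (x ^ 3 - x ^ 2)]
  have e : 1 / x - 1 - radialMomentum x ^ 2 =
      (1 - x) * (1 - x * (1 - x) * (13 / 4 - 5 * x + 4 * x ^ 2) ^ 2) / x := by
    rw [radialMomentum]; field_simp
  have : 0 ≤ (1 - x) * (1 - x * (1 - x) * (13 / 4 - 5 * x + 4 * x ^ 2) ^ 2) / x :=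
    div_nonneg (mul_nonneg (sub_nonneg.2 h1) (sub_nonneg.2 key)) h0.le
  linarith

/-- Young's inequality `p w ≤ w² / 2 + p² / 2` with `p` the calibrating momentum; the subsolution
property bounds `p² / 2` by `c R / r - c`. -/
theorem radial_young {c r R w : ℝ} (hc : 0 ≤ c) (hr : 0 < r) (hrR : r ≤ R) :
    c + √(2 * c) * radialMomentum (r / R) * w ≤ w ^ 2 / 2 + c * R / r := by
  have hR : 0 < R := hr.trans_le hrR
  have h := mul_le_mul_of_nonneg_left
    (radialMomentum_sq_le (div_pos hr hR) ((div_le_one hR).2 hrR)) hc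
  have e : c * (1 / (r / R) - 1) = c * R / r - c := by field_simp
  rw [e] at h
  have h2 : √(2 * c) ^ 2 = 2 * c := Real.sq_sqrt (by positivity)
  nlinarith [sq_nonneg (w - √(2 * c) * radialMomentum (r / R)),
    mul_pow (√(2 * c)) (radialMomentum (r / R)) 2]

theorem le_lagrangian {m₀ R : ℝ} (hm₀ : 0 ≤ m₀) {u : ℝ → E3} {t : ℝ}
    (hR : 0 < R) (htR : ‖u t‖ ≤ R) (hu : DifferentiableAt ℝ u t)
    (hr : DifferentiableAt ℝ (fun s => ‖u s‖) t) :
    ENNReal.ofReal (4 * ((m₀ + 9 / 10) / R)) + 4 * ‖deriv (fun s =>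
        √(2 * ((m₀ + 9 / 10) / R)) * R * radialCalibration (‖u s‖ / R)) t‖ₑ ≤
      kineticEnergy (fun i => deriv (satellites u i) t) +
        potential m₀ (fun i => satellites u i t) := by
  by_cases h0 : u t = 0
  -- At a collision the potential is infinite, so the calibration is only needed away from the
  -- origin.
  · simp only [satellites, h0, potential_zero, add_top, le_top]
  have hpos : 0 < ‖u t‖ := norm_pos_iff.2 h0
  set c := (m₀ + 9 / 10) / R with hc
  have hc0 : 0 ≤ c := by positivity
  have hd : HasDerivAt (fun s => √(2 * c) * R * radialCalibration (‖u s‖ / R))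
      (√(2 * c) * R * (radialMomentum (‖u t‖ / R) * (deriv (fun s => ‖u s‖) t / R))) t :=
    ((hasDerivAt_radialCalibration (‖u t‖ / R)).comp t (hr.hasDerivAt.div_const R)).const_mul _
  have hγ := radialMomentum_nonneg ((div_le_one hR).2 htR)
  have e : √(2 * c) * R * (radialMomentum (‖u t‖ / R) * (deriv (fun s => ‖u s‖) t / R)) =
      √(2 * c) * radialMomentum (‖u t‖ / R) * deriv (fun s => ‖u s‖) t := by
    field_simp
  have hb : ‖deriv (fun s => √(2 * c) * R * radialCalibration (‖u s‖ / R)) t‖ ≤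
      √(2 * c) * radialMomentum (‖u t‖ / R) * ‖deriv u t‖ := by
    rw [hd.deriv, e, norm_mul, Real.norm_of_nonneg (by positivity), Real.norm_eq_abs]
    exact mul_le_mul_of_nonneg_left (abs_deriv_norm_le hu hr) (by positivity)
  have hy := radial_young (w := ‖deriv u t‖) hc0 hpos htR
  rw [kineticEnergy_satellites hu]
  refine le_trans ?_ (add_le_add_right (le_potential hm₀ h0) _)
  rw [← ofReal_norm, ← ENNReal.ofReal_ofNat 4, ← ENNReal.ofReal_mul (by norm_num),
    ← ENNReal.ofReal_add (by positivity) (by positivity),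
    ← ENNReal.ofReal_add (by positivity) (by positivity)]
  refine ENNReal.ofReal_le_ofReal ?_
  have e2 : c * R = m₀ + 9 / 10 := by rw [hc]; field_simp
  rw [e2] at hy
  linarith

theorem absolutelyContinuousOnInterval_radialCalibration {r : ℝ → ℝ} {a b : ℝ} (k R : ℝ)
    (hr : AbsolutelyContinuousOnInterval r a b) :
    AbsolutelyContinuousOnInterval (fun t => k * radialCalibration (r t / R)) a b := by
  have hc : ∀ z : ℝ, AbsolutelyContinuousOnInterval (fun _ : ℝ => z) a b := fun z =>
    contDiffOn_const.absolutelyContinuousOnInterval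
  have hx : AbsolutelyContinuousOnInterval (fun t => r t / R) a b := by
    simpa only [div_eq_inv_mul] using hr.const_mul R⁻¹
  exact ((hx.fun_mul ((hc _).add (hx.fun_mul ((hc _).add (hx.fun_mul
    ((hc _).add (hx.const_mul (-1)))))))).const_mul k)

/-- With `R` the largest distance from the centre, the action of a motion through a total collision
is at least the sum of the energy term and four radial excursions between `0` and `R`. -/
theorem le_action_of_collision {m₀ T R p q : ℝ} (hm₀ : 0 ≤ m₀) (hT : 0 < T) {u : ℝ → E3}
    (hu : AbsolutelyContinuousOnInterval u 0 T) (hR : 0 < R) (hle : ∀ t, ‖u t‖ ≤ R)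
    (hper : ∀ t, ‖u (t + T / 2)‖ = ‖u t‖) (hp : p ∈ Icc 0 (T / 2)) (hq : q ∈ Icc 0 (T / 2))
    (hup : u p = 0) (huq : ‖u q‖ = R) :
    ENNReal.ofReal (4 * ((m₀ + 9 / 10) * T / R + 9 / 2 * √(2 * (m₀ + 9 / 10) * R))) ≤
      action m₀ T u := by
  set c := (m₀ + 9 / 10) / R with hc
  have hc0 : 0 < c := by positivity
  set H : ℝ → ℝ := fun s => √(2 * c) * R * radialCalibration (‖u s‖ / R) with hH
  have hHac : AbsolutelyContinuousOnInterval H 0 T :=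
    absolutelyContinuousOnInterval_radialCalibration _ R hu.norm
  have hHper : ∀ t, H (t + T / 2) = H t := fun t => by simp only [hH, hper]
  have hT2 : 0 ≤ T / 2 := by positivity
  have hT3 : T / 2 ≤ T := by linarith
  have hHp : H p = 0 := by simp [hH, hup, radialCalibration]
  have hHq : H q = 9 / 8 * √(2 * (m₀ + 9 / 10) * R) := by
    have : √(2 * (m₀ + 9 / 10) * R) = √(2 * c) * R := by
      rw [show 2 * (m₀ + 9 / 10) * R = 2 * c * R ^ 2 by rw [hc]; field_simp,
        Real.sqrt_mul (by positivity), Real.sqrt_sq hR.le]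
    simp only [hH, huq, div_self hR.ne', radialCalibration, this]
    ring
  -- `H` is a closed curve on each half period, so each half contributes twice the excursion `H q -
  -- H p`.
  have b1 := two_mul_enorm_sub_le_lintegral_deriv
    (hHac.mono (c := 0) (d := T / 2) (by
      rw [uIcc_of_le hT2, uIcc_of_le hT.le]; exact Icc_subset_Icc_right hT3)) hp hq
    (by simpa using (hHper 0).symm)
  have b2 := two_mul_enorm_sub_le_lintegral_deriv (p := p + T / 2) (q := q + T / 2)
    (hHac.mono (c := T / 2) (d := T) (by
      rw [uIcc_of_le hT3, uIcc_of_le hT.le]; exact Icc_subset_Icc_left hT2))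
    ⟨by linarith [hp.1], by linarith [hp.2]⟩ ⟨by linarith [hq.1], by linarith [hq.2]⟩
    (by simpa using (hHper (T / 2)).symm)
  rw [hHper, hHper] at b2
  have hsplit : ∫⁻ t in Ioc 0 T, ‖deriv H t‖ₑ =
      (∫⁻ t in Ioc 0 (T / 2), ‖deriv H t‖ₑ) + ∫⁻ t in Ioc (T / 2) T, ‖deriv H t‖ₑ := by
    rw [← lintegral_union measurableSet_Ioc (Ioc_disjoint_Ioc_of_le le_rfl),
      Ioc_union_Ioc_eq_Ioc hT2 hT3]
  have hvar : 4 * ENNReal.ofReal (9 / 8 * √(2 * (m₀ + 9 / 10) * R)) ≤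
      ∫⁻ t in Ioc 0 T, ‖deriv H t‖ₑ := by
    have e : ENNReal.ofReal (9 / 8 * √(2 * (m₀ + 9 / 10) * R)) = ‖H q - H p‖ₑ := by
      rw [hHp, sub_zero, hHq, Real.enorm_of_nonneg (by positivity)]
    rw [e, hsplit, show (4 : ℝ≥0∞) = 2 + 2 by norm_num, add_mul]
    exact add_le_add b1 b2
  have hae : ∀ᵐ t ∂volume.restrict (Ioc 0 T),
      ENNReal.ofReal (4 * c) + 4 * ‖deriv H t‖ₑ ≤
        kineticEnergy (fun i => deriv (satellites u i) t) +
          potential m₀ (fun i => satellites u i t) := by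
    rw [ae_restrict_iff' measurableSet_Ioc]
    filter_upwards [hu.boundedVariationOn.ae_differentiableAt_of_mem_uIcc,
      hu.norm.ae_differentiableAt] with t h1 h2 ht
    have ht' : t ∈ uIcc 0 T := by rw [uIcc_of_le hT.le]; exact Ioc_subset_Icc_self ht
    exact le_lagrangian hm₀ hR (hle t) (h1 ht') (h2 ht')
  refine le_trans ?_ (lintegral_mono_ae hae)
  rw [lintegral_add_left measurable_const, lintegral_const_mul' _ _ (by simp),
    setLIntegral_const, Real.volume_Ioc, sub_zero, ← ENNReal.ofReal_mul (by positivity)]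
  refine le_trans (le_of_eq ?_) (add_le_add_right (mul_le_mul_right hvar 4) _)
  rw [← mul_assoc, show (4 : ℝ≥0∞) * 4 = ENNReal.ofReal 16 by norm_num,
    ← ENNReal.ofReal_mul (by norm_num), ← ENNReal.ofReal_add (by positivity) (by positivity)]
  congr 1
  rw [hc]
  ring

/-! ### A collision-free competitor -/

/-- A loop winding once around the first axis on a cylinder of radius `b`. -/
noncomputable def tennisLoop (b ω t : ℝ) : E3 :=
  !₂[b / 2 * Real.cos (2 * (ω * t)), b * Real.cos (ω * t), b * Real.sin (ω * t)]

theorem hasDerivAt_tennisLoop (b ω t : ℝ) :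
    HasDerivAt (tennisLoop b ω) !₂[-(b * ω * Real.sin (2 * (ω * t))), -(b * ω * Real.sin (ω * t)),
      b * ω * Real.cos (ω * t)] t := by
  have h : HasDerivAt (fun s => ω * s) ω t := by simpa using (hasDerivAt_id t).const_mul ω
  refine (PiLp.continuousLinearEquiv 2 ℝ fun _ : Fin 3 => ℝ).symm.hasFDerivAt.comp_hasDerivAt t
    (hasDerivAt_pi.2 fun i => ?_)
  fin_cases i
  · convert! ((h.const_mul 2).cos.const_mul (b / 2)) using 1
    simp; ring
  · convert! (h.cos.const_mul b) using 1
    simp; ring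
  · convert! (h.sin.const_mul b) using 1
    simp; ring

theorem contDiff_tennisLoop (b ω : ℝ) : ContDiff ℝ 1 (tennisLoop b ω) := by
  rw [contDiff_euclidean]
  intro i
  fin_cases i <;> simp [tennisLoop] <;> fun_prop

theorem norm_deriv_tennisLoop_sq (b ω t : ℝ) :
    ‖deriv (tennisLoop b ω) t‖ ^ 2 = b ^ 2 * ω ^ 2 * (1 + Real.sin (2 * (ω * t)) ^ 2) := by
  rw [(hasDerivAt_tennisLoop b ω t).deriv, norm_sq_eq_coords]
  simp
  linear_combination b ^ 2 * ω ^ 2 * Real.sin_sq_add_cos_sq (ω * t)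

theorem isH1Loop_tennisLoop {T b ω : ℝ} (hω : ω * T = 2 * Real.pi) :
    IsH1Loop T (tennisLoop b ω) where
  periodic t := by
    have e : ω * (t + T) = ω * t + 2 * Real.pi := by rw [mul_add, hω]
    have e2 : 2 * (ω * t + 2 * Real.pi) = 2 * (ω * t) + 2 * Real.pi + 2 * Real.pi := by ring
    simp only [tennisLoop, e, e2, Real.cos_add_two_pi, Real.sin_add_two_pi]
  absolutelyContinuous := (contDiff_tennisLoop b ω).contDiffOn.absolutelyContinuousOnInterval
  memLp_deriv := by
    refine MemLp.of_bound
      ((contDiff_tennisLoop b ω).continuous_deriv le_rfl).aestronglyMeasurable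
      (2 * |b * ω|) (Filter.Eventually.of_forall fun t => ?_)
    refine abs_le_of_sq_le_sq' ?_ (by positivity) |>.2
    rw [norm_deriv_tennisLoop_sq, mul_pow, sq_abs, mul_pow]
    nlinarith [mul_le_mul_of_nonneg_left (Real.sin_sq_le_one (2 * (ω * t)))
      (mul_nonneg (sq_nonneg b) (sq_nonneg ω)), mul_nonneg (sq_nonneg b) (sq_nonneg ω)]

/-- On an axis two coordinates vanish. The last two are never zero together, and where `cos (2 ω t)
= 0` neither `cos (ω t)` nor `sin (ω t)` vanishes. -/
theorem tennisLoop_notMem_collisionSet {b : ℝ} (hb : 0 < b) (ω t : ℝ) :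
    tennisLoop b ω t ∉ collisionSet := by
  rintro ⟨i, hi, h⟩
  have h0 := congrArg (fun x : E3 => x 0) h
  have h1 := congrArg (fun x : E3 => x 1) h
  have h2 := congrArg (fun x : E3 => x 2) h
  have hsc := Real.sin_sq_add_cos_sq (ω * t)
  have hc := Real.cos_two_mul (ω * t)
  have zero : ∀ z : ℝ, -(b * z) = b * z → z = 0 := fun z hz => by
    have : b * z = 0 := by linarith
    exact (mul_eq_zero.1 this).resolve_left hb.ne'
  fin_cases i
  · exact hi rfl
  · simp only [Fin.mk_one, kleinRot_one_apply] at h1 h2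
    have a1 := zero _ h1
    have a2 := zero _ h2
    simp [a1, a2] at hsc
  · simp only [Fin.reduceFinMk, kleinRot_two_apply] at h0 h2
    have a0 := zero (1 / 2 * Real.cos (2 * (ω * t)))
      (by simpa [tennisLoop, mul_div_assoc, div_eq_mul_inv, mul_assoc] using h0)
    have a2 := zero _ h2
    rw [a2] at hsc
    nlinarith
  · simp only [Fin.reduceFinMk, kleinRot_three_apply] at h0 h1
    have a0 := zero (1 / 2 * Real.cos (2 * (ω * t)))
      (by simpa [tennisLoop, mul_div_assoc, div_eq_mul_inv, mul_assoc] using h0)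
    have a1 := zero _ h1
    rw [a1] at hc
    nlinarith

theorem tennisLoop_mem_admissibleLoops {T b ω : ℝ} (hb : 0 < b) (hω : ω * T = 2 * Real.pi) :
    tennisLoop b ω ∈ admissibleLoops T := by
  refine ⟨isH1Loop_tennisLoop hω, tennisLoop_notMem_collisionSet hb ω, fun t => ?_, fun t => ?_,
    ⟨b / 2, b, by positivity, hb, ?_⟩, ⟨b / 2, b, by positivity, hb, ?_⟩⟩
  · ext k
    rw [coordReflection_apply]
    fin_cases k <;> simp [tennisLoop]
  · have e : ω * (T / 2 - t) = Real.pi - ω * t := by linear_combination hω / 2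
    have e2 : 2 * (Real.pi - ω * t) = 2 * Real.pi - 2 * (ω * t) := by ring
    ext k
    rw [coordReflection_apply]
    fin_cases k <;>
      simp [tennisLoop, e, e2, Real.cos_pi_sub, Real.sin_pi_sub, Real.cos_two_pi_sub]
  · simp [tennisLoop]
  · have e : ω * (T / 4) = Real.pi / 2 := by linear_combination hω / 4
    have e2 : 2 * (Real.pi / 2) = Real.pi := by ring
    simp [tennisLoop, e, e2]

/-- An affine majorant of `1 / √(1 / 4 + s ^ 2)` on `[0, 1]`. It is applied at `s` and at `1 - s`,
so the dependence on `s` cancels in the sum and the potential bound is constant in time. -/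
theorem one_div_axisDist_le {ρ b s : ℝ} (hρ : 0 < ρ) (hb : 0 < b) (h0 : 0 ≤ s) (h1 : s ≤ 1)
    (h : ρ ^ 2 = b ^ 2 * (1 / 4 + s ^ 2)) : 1 / ρ ≤ (43 / 20 - 6 / 5 * s) / b := by
  have key : 1 ≤ (43 / 20 - 6 / 5 * s) ^ 2 * (1 / 4 + s ^ 2) := by
    nlinarith [mul_nonneg h0 (sub_nonneg.2 h1), sq_nonneg (s - 1 / 5),
      sq_nonneg (s * (s - 1 / 5)), sq_nonneg (s * (s - 1))]
  rw [div_le_div_iff₀ hρ hb]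
  have hs : 0 ≤ 43 / 20 - 6 / 5 * s := by linarith
  refine (abs_le_of_sq_le_sq' ?_ (by positivity)).2
  rw [mul_pow, mul_pow, h]
  nlinarith [mul_le_mul_of_nonneg_left key (sq_nonneg b)]

theorem lagrangian_tennisLoop_le {m₀ b : ℝ} (hm₀ : 0 ≤ m₀) (hb : 0 < b) (ω t : ℝ) :
    kineticEnergy (fun i => deriv (satellites (tennisLoop b ω) i) t) +
        potential m₀ (fun i => satellites (tennisLoop b ω) i t) ≤
      ENNReal.ofReal (2 * (b ^ 2 * ω ^ 2 * (1 + Real.sin (2 * (ω * t)) ^ 2)) +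
        4 * ((m₀ + 41 / 40) / b)) := by
  set x := tennisLoop b ω t with hx
  set s := Real.sin (ω * t) with hs
  have hs1 : s ^ 2 ≤ 1 := Real.sin_sq_le_one _
  have hcos : Real.cos (ω * t) ^ 2 = 1 - s ^ 2 := Real.cos_sq' _
  have hcos2 : Real.cos (2 * (ω * t)) = 1 - 2 * s ^ 2 := by rw [Real.cos_two_mul, hcos]; ring
  have hx0 : x 0 = b / 2 * (1 - 2 * s ^ 2) := by rw [← hcos2]; rfl
  have hx1 : x 1 ^ 2 = b ^ 2 * (1 - s ^ 2) := by rw [← hcos, ← mul_pow]; rfl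
  have hx2 : x 2 ^ 2 = b ^ 2 * s ^ 2 := by rw [← mul_pow]; rfl
  have hn : ‖x‖ ^ 2 = b ^ 2 / 4 * (1 - 2 * s ^ 2) ^ 2 + b ^ 2 := by
    rw [norm_sq_eq_coords, hx0, hx1, hx2]; ring
  have r0 : axisDist 0 x ^ 2 = b ^ 2 := by rw [axisDist_sq, hn, hx0]; ring
  have r1 : axisDist 1 x ^ 2 = b ^ 2 * (1 / 4 + (s ^ 2) ^ 2) := by
    rw [axisDist_sq, hn, hx1]; ring
  have r2 : axisDist 2 x ^ 2 = b ^ 2 * (1 / 4 + (1 - s ^ 2) ^ 2) := by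
    rw [axisDist_sq, hn, hx2]; ring
  have pos : ∀ k, 0 < axisDist k x := fun k => by
    refine lt_of_le_of_ne (axisDist_nonneg k x) fun h => ?_
    have : axisDist k x ^ 2 ≠ 0 := by
      fin_cases k
      · simp only [Fin.zero_eta, r0]; positivity
      · simp only [Fin.mk_one, r1]; positivity
      · simp only [Fin.reduceFinMk, r2]; positivity
    exact this (by rw [← h]; simp)
  have hbx : b ≤ ‖x‖ := by
    refine (abs_le_of_sq_le_sq' ?_ (norm_nonneg _)).2
    rw [hn]
    nlinarith [mul_nonneg (sq_nonneg b) (sq_nonneg (1 - 2 * s ^ 2))]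
  have hne : x ≠ 0 := norm_pos_iff.1 (hb.trans_le hbx)
  have p0 : 1 / axisDist 0 x = 1 / b := by
    rw [(sq_eq_sq₀ (axisDist_nonneg 0 x) hb.le).1 r0]
  have p1 := one_div_axisDist_le (pos 1) hb (sq_nonneg s) hs1 r1
  have p2 := one_div_axisDist_le (pos 2) hb (sub_nonneg.2 hs1) (by linarith [sq_nonneg s]) r2
  have p3 : m₀ / ‖x‖ ≤ m₀ / b := div_le_div_of_nonneg_left hm₀ hb hbx
  have hdiff : DifferentiableAt ℝ (tennisLoop b ω) t :=
    (hasDerivAt_tennisLoop b ω t).differentiableAt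
  rw [kineticEnergy_satellites hdiff, norm_deriv_tennisLoop_sq]
  simp only [satellites]
  rw [← hx, potential_eq_ofReal hm₀ hne pos, ← ENNReal.ofReal_add (by positivity)
    (add_nonneg (by positivity) (Finset.sum_nonneg fun k _ => by have := pos k; positivity))]
  refine ENNReal.ofReal_le_ofReal ?_
  rw [Fin.sum_univ_three, p0]
  -- The constant is `1 + 2 * (43 / 20) - 6 / 5 = 4 * (41 / 40)`.
  have e : 4 * ((m₀ + 41 / 40) / b) = 4 * (m₀ / b) + (1 / b + ((43 / 20 - 6 / 5 * s ^ 2) / b +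
      (43 / 20 - 6 / 5 * (1 - s ^ 2)) / b)) := by ring
  rw [e]
  linarith

theorem action_tennisLoop_le {m₀ T b ω : ℝ} (hm₀ : 0 ≤ m₀) (hT : 0 < T) (hb : 0 < b)
    (hω : ω * T = 2 * Real.pi) :
    action m₀ T (tennisLoop b ω) ≤
      ENNReal.ofReal (4 * T * (3 / 4 * b ^ 2 * ω ^ 2 + (m₀ + 41 / 40) / b)) := by
  refine (lintegral_mono fun t => lagrangian_tennisLoop_le hm₀ hb ω t).trans ?_
  have hω0 : ω ≠ 0 := fun h => by
    rw [h, zero_mul] at hω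
    exact Real.two_pi_pos.ne hω
  rw [← ofReal_integral_eq_lintegral_ofReal, ← intervalIntegral.integral_of_le hT.le]
  · refine ENNReal.ofReal_le_ofReal (le_of_eq ?_)
    have hsin : ∫ t in (0 : ℝ)..T, Real.sin (2 * (ω * t)) ^ 2 = T / 2 := by
      have e : ∀ t : ℝ, 2 * (ω * t) = (2 * ω) * t := fun t => by ring
      have e2 : 2 * ω * T = (2 : ℕ) * (2 * Real.pi) := by push_cast; linear_combination 2 * hω
      simp only [e]
      rw [intervalIntegral.integral_comp_mul_left (fun x => Real.sin x ^ 2)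
        (mul_ne_zero two_ne_zero hω0), integral_sin_sq, e2]
      have : Real.sin ((2 : ℕ) * (2 * Real.pi)) = 0 := by
        rw [show ((2 : ℕ) : ℝ) * (2 * Real.pi) = (4 : ℕ) * Real.pi by push_cast; ring]
        exact Real.sin_nat_mul_pi 4
      rw [this]
      push_cast
      simp only [mul_zero, Real.sin_zero, zero_mul, sub_zero, zero_add, smul_eq_mul]
      rw [← hω]
      field_simp
    rw [intervalIntegral.integral_add (Continuous.intervalIntegrable (by fun_prop) _ _)
      intervalIntegrable_const]
    rw [intervalIntegral.integral_const_mul, intervalIntegral.integral_const_mul,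
      intervalIntegral.integral_add intervalIntegrable_const
        (Continuous.intervalIntegrable (by fun_prop) _ _),
      hsin]
    simp only [intervalIntegral.integral_const, smul_eq_mul]
    ring
  · exact (Continuous.intervalIntegrable (by fun_prop) 0 T).1
  · exact Filter.Eventually.of_forall fun t => by positivity

/-! ### Symmetry of the loops in the closure -/

/-- The two time reversals compose to the shift by `T / 2`, and the two reflections are isometries.
-/
theorem norm_add_half_period_of_mem_admissibleLoops {T : ℝ} {v : ℝ → E3}
    (hv : v ∈ admissibleLoops T) (t : ℝ) : ‖v (t + T / 2)‖ = ‖v t‖ := by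
  obtain ⟨-, -, h3, h2, -, -⟩ := hv
  rw [h2 (t + T / 2), norm_coordReflection, h3 t, norm_coordReflection]
  congr 2
  ring

/-- The defect of half-period symmetry of `‖u‖` is controlled in `L²` by the distance from `u` to
any loop with that symmetry, so the symmetry passes to limits. -/
theorem lintegral_sq_norm_sub_norm_le {T : ℝ} (hT : 0 < T) {u v : ℝ → E3}
    (hu : AbsolutelyContinuousOnInterval u 0 T) (hv : AbsolutelyContinuousOnInterval v 0 T)
    (hper : ∀ t, ‖v (t + T / 2)‖ = ‖v t‖) :
    ∫⁻ t in Ioc 0 (T / 2), ‖‖u (t + T / 2)‖ - ‖u t‖‖ₑ ^ 2 ≤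
      2 * ∫⁻ t in Ioc 0 T, ‖u t - v t‖ₑ ^ 2 := by
  have hT2 : 0 ≤ T / 2 := by positivity
  have hT3 : T / 2 ≤ T := by linarith
  have hpt : ∀ t, ‖‖u (t + T / 2)‖ - ‖u t‖‖ₑ ^ 2 ≤
      2 * (‖u (t + T / 2) - v (t + T / 2)‖ₑ ^ 2 + ‖u t - v t‖ₑ ^ 2) := fun t => by
    have e2 : ∀ y : ℝ≥0∞, 2 * y = ENNReal.ofReal 2 * y := by simp
    simp only [← ofReal_norm]
    rw [← ENNReal.ofReal_pow (norm_nonneg _), ← ENNReal.ofReal_pow (norm_nonneg _),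
      ← ENNReal.ofReal_pow (norm_nonneg _), ← ENNReal.ofReal_add (sq_nonneg _) (sq_nonneg _),
      e2, ← ENNReal.ofReal_mul zero_le_two]
    refine ENNReal.ofReal_le_ofReal (le_trans (pow_le_pow_left₀ (norm_nonneg _) ?_ 2) add_sq_le)
    have h1 := abs_norm_sub_norm_le (u (t + T / 2)) (v (t + T / 2))
    have h2 := abs_norm_sub_norm_le (u t) (v t)
    rw [hper] at h1
    rw [Real.norm_eq_abs, abs_le]
    rw [abs_le] at h1 h2
    constructor <;> linarith [h1.1, h1.2, h2.1, h2.2]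
  have hcont : ContinuousOn (fun t => u t - v t) (Icc 0 T) := by
    rw [← uIcc_of_le hT.le]
    exact hu.continuousOn.sub hv.continuousOn
  have hmeas : AEMeasurable (fun t => ‖u t - v t‖ₑ ^ 2) (volume.restrict (Ioc 0 (T / 2))) :=
    ((hcont.mono ((Ioc_subset_Ioc_right hT3).trans Ioc_subset_Icc_self)).aestronglyMeasurable
      measurableSet_Ioc).enorm.pow_const 2
  have hshift : ∫⁻ t in Ioc 0 (T / 2), ‖u (t + T / 2) - v (t + T / 2)‖ₑ ^ 2 =
      ∫⁻ t in Ioc (T / 2) T, ‖u t - v t‖ₑ ^ 2 := by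
    have h := (measurePreserving_add_right volume (T / 2)).setLIntegral_comp_preimage_emb
      (measurableEmbedding_addRight (T / 2)) (fun t => ‖u t - v t‖ₑ ^ 2) (Ioc (T / 2) T)
    rw [← h, preimage_add_const_Ioc, sub_self, sub_half]
  calc ∫⁻ t in Ioc 0 (T / 2), ‖‖u (t + T / 2)‖ - ‖u t‖‖ₑ ^ 2
      ≤ ∫⁻ t in Ioc 0 (T / 2),
          2 * (‖u (t + T / 2) - v (t + T / 2)‖ₑ ^ 2 + ‖u t - v t‖ₑ ^ 2) := lintegral_mono hpt
    _ = 2 * ((∫⁻ t in Ioc (T / 2) T, ‖u t - v t‖ₑ ^ 2) +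
          ∫⁻ t in Ioc 0 (T / 2), ‖u t - v t‖ₑ ^ 2) := by
        rw [lintegral_const_mul' _ _ (by simp), lintegral_add_right' _ hmeas, hshift]
    _ = _ := by
        rw [add_comm, ← lintegral_union measurableSet_Ioc (Ioc_disjoint_Ioc_of_le le_rfl),
          Ioc_union_Ioc_eq_Ioc hT2 hT3]

theorem norm_add_half_period_of_mem_h1Closure {T : ℝ} (hT : 0 < T) {u : ℝ → E3}
    (hu : u ∈ h1Closure T (admissibleLoops T)) (t : ℝ) : ‖u (t + T / 2)‖ = ‖u t‖ := by
  obtain ⟨hloop, happ⟩ := hu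
  have hT2 : 0 < T / 2 := by positivity
  have hcont : ContinuousOn u (Icc 0 T) := by
    simpa only [uIcc_of_le hT.le] using hloop.absolutelyContinuous.continuousOn
  have c1 : ContinuousOn (fun s => ‖u s‖) (Icc 0 (T / 2)) :=
    (hcont.mono (Icc_subset_Icc_right (by linarith))).norm
  have c2 : ContinuousOn (fun s => ‖u (s + T / 2)‖) (Icc 0 (T / 2)) :=
    (hcont.comp (by fun_prop) fun s hs => ⟨by linarith [hs.1], by linarith [hs.2]⟩).norm
  have hzero : ∫⁻ s in Ioc 0 (T / 2), ‖‖u (s + T / 2)‖ - ‖u s‖‖ₑ ^ 2 = 0 := by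
    set D := ∫⁻ s in Ioc 0 (T / 2), ‖‖u (s + T / 2)‖ - ‖u s‖‖ₑ ^ 2
    by_contra hD
    -- The distance is a square root and the defect is at most twice its square, so this radius
    -- would force `D < D`.
    obtain ⟨v, hv, hlt⟩ := happ ((D / 2) ^ (1 / 2 : ℝ))
      (ENNReal.rpow_pos_of_nonneg (ENNReal.half_pos hD) (by norm_num))
    rw [h1Dist, ENNReal.rpow_lt_rpow_iff (by norm_num)] at hlt
    have h1 := lintegral_sq_norm_sub_norm_le hT hloop.absolutelyContinuous
      hv.1.absolutelyContinuous (norm_add_half_period_of_mem_admissibleLoops hv)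
    have h2 : ∫⁻ s in Ioc 0 T, ‖u s - v s‖ₑ ^ 2 < D / 2 :=
      (lintegral_mono fun s => le_self_add).trans_lt hlt
    have h3 : 2 * ∫⁻ s in Ioc 0 T, ‖u s - v s‖ₑ ^ 2 < D := by
      rw [mul_comm]
      exact ENNReal.mul_lt_of_lt_div h2
    exact (h1.trans_lt h3).ne rfl
  have hmeas : AEMeasurable (fun s => ‖‖u (s + T / 2)‖ - ‖u s‖‖ₑ ^ 2)
      (volume.restrict (Ioc 0 (T / 2))) :=
    (((c2.sub c1).mono Ioc_subset_Icc_self).aestronglyMeasurable measurableSet_Ioc).enorm.pow_const 2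
  have hae := (lintegral_eq_zero_iff' hmeas).1 hzero
  rw [Measure.restrict_congr_set Ioc_ae_eq_Icc] at hae
  have heq : EqOn (fun s => ‖u (s + T / 2)‖) (fun s => ‖u s‖) (Icc 0 (T / 2)) := by
    refine Measure.eqOn_Icc_of_ae_eq volume hT2.ne ?_ c2 c1
    filter_upwards [hae] with s hs
    simpa [sub_eq_zero] using hs
  have hper : Function.Periodic (fun s => ‖u (s + T / 2)‖ - ‖u s‖) T := fun s => by
    have := hloop.periodic (s + T / 2)
    simp only [show s + T + T / 2 = s + T / 2 + T by ring, this, hloop.periodic s]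
  obtain ⟨s, hs, hts⟩ := hper.exists_mem_Ico₀ hT t
  rw [← sub_eq_zero, hts, sub_eq_zero]
  rcases le_total s (T / 2) with h | h
  · exact heq ⟨hs.1, h⟩
  · have h1 := heq (x := s - T / 2) ⟨by linarith, by linarith [hs.2]⟩
    simp only [sub_add_cancel] at h1
    rw [h1, show s + T / 2 = s - T / 2 + T by ring, hloop.periodic]

/-! ### Comparison of the two levels -/

theorem subset_h1Closure {T : ℝ} {K : Set (ℝ → E3)} {u : ℝ → E3} (hu : u ∈ K)
    (hloop : IsH1Loop T u) : u ∈ h1Closure T K :=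
  ⟨hloop, fun ε hε => ⟨u, hu, by simpa [h1Dist] using hε⟩⟩

theorem action_eq_top_of_eq_zero {m₀ T : ℝ} (hT : 0 < T) {u : ℝ → E3} (hu : ∀ t, u t = 0) :
    action m₀ T u = ⊤ := by
  simp only [action, satellites, hu, potential_zero, add_top]
  simp [ENNReal.top_mul, hT]

/-- The arithmetic-geometric inequality for `x, y / 2, y / 2`. In the application `x` scales as `1 /
R` and `y` as `√R`, so `x * y ^ 2` is independent of `R`. -/
theorem four_mul_cube_add_ge {x y : ℝ} (hx : 0 ≤ x) (hy : 0 ≤ y) :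
    27 * (x * y ^ 2) ≤ 4 * (x + y) ^ 3 := by
  have : 4 * (x + y) ^ 3 - 27 * (x * y ^ 2) = (2 * x - y) ^ 2 * (x + 4 * y) := by ring
  have : 0 ≤ (2 * x - y) ^ 2 * (x + 4 * y) := by positivity
  linarith

/-- The level of the competitor of optimal radius is below the collision level, whatever the size
`R` of the colliding motion. -/
theorem exists_radius_action_lt {m₀ T : ℝ} (hm₀ : 0 ≤ m₀) (hT : 0 < T) :
    ∃ b : ℝ, 0 < b ∧ ∀ R : ℝ, 0 < R →
      T * (3 / 4 * b ^ 2 * (2 * Real.pi / T) ^ 2 + (m₀ + 41 / 40) / b) <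
        (m₀ + 9 / 10) * T / R + 9 / 2 * √(2 * (m₀ + 9 / 10) * R) := by
  have hπ := Real.pi_pos
  set Q := m₀ + 41 / 40 with hQ
  set α := m₀ + 9 / 10 with hα
  have hQ0 : 0 < Q := by positivity
  have hα0 : 0 < α := by positivity
  -- The cube of the critical radius of `b ↦ 3 π² b² / T² + Q / b`.
  set z := Q * T ^ 2 / (6 * Real.pi ^ 2) with hz
  have hz0 : 0 < z := by positivity
  have hb3 : (z ^ (1 / 3 : ℝ)) ^ 3 = z := by
    rw [← Real.rpow_natCast, ← Real.rpow_mul hz0.le]; norm_num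
  have hb0 : 0 < z ^ (1 / 3 : ℝ) := Real.rpow_pos_of_pos hz0 _
  generalize z ^ (1 / 3 : ℝ) = b at hb3 hb0
  refine ⟨b, hb0, fun R hR => ?_⟩
  have hQb : Q * T ^ 2 = b ^ 3 * (6 * Real.pi ^ 2) := by rw [hb3, hz]; field_simp
  have e : T * (3 / 4 * b ^ 2 * (2 * Real.pi / T) ^ 2 + Q / b) = 3 / 2 * (T * Q / b) := by
    have : 3 / 4 * b ^ 2 * (2 * Real.pi / T) ^ 2 = Q / (2 * b) := by
      field_simp
      linear_combination -4 * hQb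
    rw [this]; field_simp; norm_num
  rw [e]
  set X := α * T / R with hX
  set Y := 9 / 2 * √(2 * α * R) with hY
  have hX0 : 0 < X := by positivity
  have hY0 : 0 ≤ Y := by positivity
  have hXY : X * Y ^ 2 = 81 / 2 * α ^ 2 * T := by
    rw [hX, hY, mul_pow, Real.sq_sqrt (by positivity)]; field_simp; norm_num
  have hcube : (3 / 2 * (T * Q / b)) ^ 3 = 81 / 4 * Real.pi ^ 2 * Q ^ 2 * T := by
    have : (3 / 2 * (T * Q / b)) ^ 3 = 27 / 8 * (T * Q ^ 2) * (Q * T ^ 2) / b ^ 3 := by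
      field_simp; norm_num
    rw [this, hQb]; field_simp; norm_num
  have hpi2 : Real.pi ^ 2 < 9.87 := by nlinarith [Real.pi_lt_d4]
  -- The numerical heart, `π² Q² < (27/2) α²`. The ratio `Q / α` is largest at `m₀ = 0`, where it is
  -- `41/36` and the left side is about `12.8 α²`.
  have hnum : 3 * (Real.pi ^ 2 * Q ^ 2) < 2 * (81 / 4) * α ^ 2 := by
    have h1 : Real.pi ^ 2 * Q ^ 2 ≤ 9.87 * Q ^ 2 := by gcongr
    have h2 : 3 * (9.87 * Q ^ 2) < 2 * (81 / 4) * α ^ 2 := by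
      rw [hQ, hα]; nlinarith [sq_nonneg m₀]
    linarith
  have hge := four_mul_cube_add_ge hX0.le hY0
  rw [hXY] at hge
  refine lt_of_pow_lt_pow_left₀ 3 (by positivity) ?_
  rw [hcube]
  nlinarith [mul_lt_mul_of_pos_right hnum hT]

theorem exists_admissible_action_lt {m₀ T : ℝ} (hm₀ : 0 ≤ m₀) (hT : 0 < T) :
    ∃ v ∈ h1Closure T (admissibleLoops T), action m₀ T v < ⊤ ∧ ∀ R : ℝ, 0 < R →
      action m₀ T v <
        ENNReal.ofReal (4 * ((m₀ + 9 / 10) * T / R + 9 / 2 * √(2 * (m₀ + 9 / 10) * R))) := by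
  obtain ⟨b, hb, hlt⟩ := exists_radius_action_lt hm₀ hT
  have hω : 2 * Real.pi / T * T = 2 * Real.pi := by field_simp
  have hle := action_tennisLoop_le hm₀ hT hb hω
  refine ⟨_, subset_h1Closure (tennisLoop_mem_admissibleLoops hb hω) (isH1Loop_tennisLoop hω),
    hle.trans_lt ENNReal.ofReal_lt_top, fun R hR => hle.trans_lt ?_⟩
  have := hlt R hR
  refine (ENNReal.ofReal_lt_ofReal_iff (by positivity)).2 ?_
  rw [mul_assoc]
  linarith

theorem not_hasTotalCollision_of_isMinOn {m₀ T : ℝ} (hm₀ : 0 ≤ m₀) (hT : 0 < T) {u : ℝ → E3}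
    (hu : u ∈ h1Closure T (admissibleLoops T))
    (hmin : IsMinOn (action m₀ T) (h1Closure T (admissibleLoops T)) u) :
    ¬ HasTotalCollision u := by
  rintro ⟨t₀, ht₀⟩
  obtain ⟨v, hv, hfin, hlt⟩ := exists_admissible_action_lt hm₀ hT
  have huv : action m₀ T u ≤ action m₀ T v := hmin hv
  have hT2 : 0 < T / 2 := by positivity
  have hper : Function.Periodic (fun t => ‖u t‖) (T / 2) :=
    norm_add_half_period_of_mem_h1Closure hT hu
  have hac := hu.1.absolutelyContinuous
  have hcont : ContinuousOn (fun t => ‖u t‖) (Icc 0 (T / 2)) := by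
    refine (hac.continuousOn.mono ?_).norm
    rw [uIcc_of_le hT.le]
    exact Icc_subset_Icc_right (by linarith)
  obtain ⟨p, hp, hpt⟩ := hper.exists_mem_Ico₀ hT2 t₀
  have hup : u p = 0 := by
    have h0 : u t₀ = 0 := by simpa only [satellites, kleinRot_zero_apply] using ht₀ 0
    simpa [h0] using hpt.symm
  obtain ⟨q, hq, hmax⟩ := isCompact_Icc.exists_isMaxOn (nonempty_Icc.2 hT2.le) hcont
  have hle : ∀ t, ‖u t‖ ≤ ‖u q‖ := fun t => by
    obtain ⟨s, hs, hts⟩ := hper.exists_mem_Ico₀ hT2 t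
    exact hts.trans_le (hmax (Ico_subset_Icc_self hs))
  -- If the maximum were zero, `u` would rest at the origin with infinite action, more than the
  -- finite action of the competitor.
  have hR : 0 < ‖u q‖ := by
    refine norm_pos_iff.2 fun h => ?_
    have := action_eq_top_of_eq_zero (m₀ := m₀) hT fun t =>
      norm_le_zero_iff.1 ((hle t).trans_eq (by rw [h, norm_zero]))
    rw [this] at huv
    exact hfin.not_ge huv
  exact absurd ((le_action_of_collision hm₀ hT hac hR hle hper (Ico_subset_Icc_self hp) hq hup
    rfl).trans huv) (hlt _ hR).not_ge

end KleinSatellites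

theorem mainTheorem8 (m₀ T : ℝ) (hm₀ : 0 ≤ m₀) (hT : 0 < T) (u : ℝ → KleinSatellites.E3)
    (hu : u ∈ KleinSatellites.h1Closure T (KleinSatellites.admissibleLoops T))
    (hmin : IsMinOn (KleinSatellites.action m₀ T)
      (KleinSatellites.h1Closure T (KleinSatellites.admissibleLoops T)) u) :
    ¬ KleinSatellites.HasTotalCollision u :=
  KleinSatellites.not_hasTotalCollision_of_isMinOn hm₀ hT hu hmin
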